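/- Let $k$ be a field, let $n\ge 3$, and let $d_1,\dots,d_n$ be positive integers with $\gcd(d_1,\dots,d_n)=1$ such that, for some integer $h\ge 1$, the sequence $h d_1, d_2,\dots,d_n$ is an arithmetic sequence with positive common difference. Put $d=\max\{d_1,\dots,d_n\}$ and let $I\subset k[x_1,\dots,x_{n+1}]$ be the toric ideal of the projective monomial curve $\{(t^{d_1}u^{d-d_1}:\cdots:t^{d_n}u^{d-d_n}:u^d) \mid (t:u)\in\mathbb{P}^1_k\}$, that is, the kernel of the $k$-algebra homomorphism $$k[x_1,\dots,x_{n+1}]\to k[t,u],\qquad x_i\mapsto t^{d_i}u^{d-d_i}\ (1\le i\le n),\quad x_{n+1}\mapsto u^{d}.$$ Then $I$ is a complete intersection (that is, the minimal number of generators of $I$ equals its height) if and only if $n=3$, the sequence $d_1,d_2,d_3$ is itself an arithmetic sequence, and $d_1$ is even. -/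

import Mathlib

open MvPolynomial

noncomputable section

/-- The toric ideal of a family of exponent vectors `b i`: the kernel of the `k`-algebra
homomorphism `k[x_i : i ∈ ι] → k[t_j : j ∈ σ]`, `x_i ↦ t ^ (b i)`. -/
def toricIdeal (k : Type*) [Field k] {ι σ : Type*} (b : ι → σ →₀ ℕ) :
    Ideal (MvPolynomial ι k) :=
  RingHom.ker (aeval (R := k) (fun i => (monomial (b i) (1 : k) : MvPolynomial σ k)))

/-- The vectors `(d_i, D - d_i)`, `i = 1, …, n`, followed by `(0, D)`, where `D` is the maximum
of the `d_i`. -/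
def projectiveExponents {n : ℕ} (d : Fin n → ℕ) : Fin (n + 1) → Fin 2 →₀ ℕ :=
  Fin.snoc (α := fun _ => Fin 2 →₀ ℕ)
    (fun i => Finsupp.equivFunOnFinite.symm ![d i, Finset.univ.sup d - d i])
    (Finsupp.equivFunOnFinite.symm ![0, Finset.univ.sup d])

/-- The toric ideal of the projective monomial curve
`(t ^ d_1 * u ^ (D - d_1) : ⋯ : t ^ d_n * u ^ (D - d_n) : u ^ D)`. -/
def projectiveToricIdeal (k : Type*) [Field k] {n : ℕ} (d : Fin n → ℕ) :
    Ideal (MvPolynomial (Fin (n + 1)) k) :=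
  toricIdeal k (projectiveExponents d)

/-- The minimal number of generators of `I` equals its height. -/
def IsCompleteIntersectionIdeal {R : Type*} [CommRing R] (I : Ideal R) : Prop :=
  Submodule.FG I ∧ ((Submodule.spanFinrank I : ℕ) : ℕ∞) = I.height

/-- An increasing arithmetic sequence of natural numbers. -/
def IsArithmeticSequence {n : ℕ} (d : Fin n → ℕ) : Prop :=
  ∃ a δ : ℕ, 0 < δ ∧ ∀ i : Fin n, d i = a + (i : ℕ) * δ

/-- `h * d_1, d_2, …, d_n` is an increasing arithmetic sequence for some positive integer `h`. -/
def IsGeneralizedArithmeticSequence {n : ℕ} (d : Fin n → ℕ) : Prop :=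
  ∃ h : ℕ, 0 < h ∧
    IsArithmeticSequence (fun i : Fin n => if (i : ℕ) = 0 then h * d i else d i)

end

/-! Two further primes above `I` show that its height is at most `n - 1`, so `I` is no complete
intersection once it needs `n` generators. Call a monomial critical if each proper divisor is alone
in its degree. Its coefficient, restricted to `I`, sees a multiplier only through the constant term,
so it vanishes on `𝔪 I`, where `𝔪 = (x_1, …, x_{n+1})`; independent such coefficients bound the
number of generators below (`card_le_spanFinrank_toricIdeal`).

The minimal non-lone powers of the `n - 1` variables `x_i` with `d_i` not maximal are critical. One
more critical monomial comes from a binomial without pure powers (`le_spanFinrank_of_arithmetic`).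
With `a = d_1` and common difference `δ` it is `x_2 x_5 - x_3 x_4` if `n ≥ 5`; `x_1^h x_4 - x_2 x_3
x_5^(h-1)` if `n = 4`, `a > 1`; `x_1^δ x_2 - x_3 x_5^δ` if `n = 4`, `a = 1`; `x_1^h x_3 - x_2^2
x_4^(h-1)` if `n = 3`, `h > 1`; `x_1^(m+δ) x_2 - x_3^(m+1) x_4^δ` if `n = 3`, `h = 1`, `a = 2m+1`.

The one case left is `n = 3`, `h = 1`, `a = 2m`. There `x_2^2 - x_1 x_3` and `x_1^(m+δ) - x_3^m
x_4^δ` generate `I`, because reduction by them gives each degree a unique normal form, and the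
height is 2. -/

section Toric

/-! ### Toric ideals: critical monomials, binomial generation, height. -/

variable {k : Type*} [Field k] {ι σ : Type*} (b : ι → σ →₀ ℕ)

theorem aeval_monomial_exponents (α : ι →₀ ℕ) (c : k) :
    aeval (R := k) (fun i => (monomial (b i) (1 : k) : MvPolynomial σ k)) (monomial α c) =
      monomial (Finsupp.linearCombination ℕ b α) c := by
  rw [aeval_monomial, Finsupp.linearCombination_apply, Finsupp.prod, Finsupp.sum]
  simp only [monomial_pow, one_pow]
  rw [← monomial_sum_one, MvPolynomial.algebraMap_eq, C_mul_monomial, mul_one]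

theorem monomial_sub_monomial_mem_toricIdeal {α β : ι →₀ ℕ}
    (h : Finsupp.linearCombination ℕ b α = Finsupp.linearCombination ℕ b β) :
    monomial α (1 : k) - monomial β 1 ∈ toricIdeal k b := by
  rw [toricIdeal, RingHom.mem_ker, map_sub, aeval_monomial_exponents, aeval_monomial_exponents, h,
    sub_self]

/-- The exponent `α` is the only one of its degree. -/
def IsLoneExponent (α : ι →₀ ℕ) : Prop :=
  ∀ β, Finsupp.linearCombination ℕ b β = Finsupp.linearCombination ℕ b α → β = α

/-- Every proper divisor of the monomial with exponent `γ` is the only monomial of its degree. -/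
def IsCriticalExponent (γ : ι →₀ ℕ) : Prop :=
  ∀ v < γ, IsLoneExponent b v

variable {b}

theorem IsLoneExponent.coeff_eq_zero {α : ι →₀ ℕ} (hα : IsLoneExponent b α)
    {f : MvPolynomial ι k} (hf : f ∈ toricIdeal k b) : coeff α f = 0 := by
  classical
  rw [toricIdeal, RingHom.mem_ker] at hf
  have h := congrArg (coeff (Finsupp.linearCombination ℕ b α)) hf
  rw [f.as_sum, map_sum, coeff_sum, coeff_zero] at h
  simp only [aeval_monomial_exponents, coeff_monomial] at h
  rw [Finset.sum_eq_single α] at h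
  · simpa using h
  · intro β _ hβ
    rw [if_neg fun h => hβ (hα β h)]
  · intro hα
    simpa using hα

/-- In the convolution over `u + v = γ`, every `v < γ` is lone, so its coefficient in `f` vanishes;
only `u = 0` survives. -/
theorem IsCriticalExponent.coeff_mul {γ : ι →₀ ℕ} (hγ : IsCriticalExponent b γ)
    (g : MvPolynomial ι k) {f : MvPolynomial ι k} (hf : f ∈ toricIdeal k b) :
    coeff γ (g * f) = constantCoeff g * coeff γ f := by
  classical
  rw [MvPolynomial.coeff_mul, Finset.sum_eq_single (0, γ)]
  · rfl
  · rintro ⟨u, v⟩ huv hne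
    rw [Finset.HasAntidiagonal.mem_antidiagonal] at huv
    simp only at huv ⊢
    rw [(hγ v _).coeff_eq_zero hf, mul_zero]
    refine lt_of_le_of_ne (huv ▸ le_add_self) ?_
    rintro rfl
    exact hne (by simpa using huv)
  · intro h
    exact absurd (Finset.HasAntidiagonal.mem_antidiagonal.2 (zero_add γ)) h

/-- Critical exponents whose coefficients are independent on a toric ideal bound the number of its
generators from below. -/
theorem card_le_spanFinrank_toricIdeal {κ : Type*} [Fintype κ] [DecidableEq κ] (γ : κ → ι →₀ ℕ)
    (hγ : ∀ j, IsCriticalExponent b (γ j)) (hfg : (toricIdeal k b).FG)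
    (hsurj : ∀ w : κ → k, ∃ f ∈ toricIdeal k b, ∀ j, coeff (γ j) f = w j) :
    Fintype.card κ ≤ Submodule.spanFinrank (toricIdeal k b) := by
  obtain ⟨s, hs, hspan⟩ := Submodule.FG.exists_span_finset_card_eq_spanFinrank hfg
  let Λ : MvPolynomial ι k → κ → k := fun f j => coeff (γ j) f
  -- Multipliers act through their constant terms, so a polynomial combination of generators becomes
  -- a `k`-combination of their images.
  have hsub : ∀ f ∈ toricIdeal k b, Λ f ∈ Submodule.span k (Λ '' (s : Set (MvPolynomial ι k))) := by
    intro f hf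
    rw [← hspan] at hf
    induction hf using Submodule.span_induction with
    | mem x hx => exact Submodule.subset_span ⟨x, hx, rfl⟩
    | zero =>
      convert Submodule.zero_mem _
      ext j; simp [Λ]
    | add x y _ _ hx hy =>
      convert Submodule.add_mem _ hx hy
      ext j; simp [Λ]
    | smul g x hx ih =>
      convert Submodule.smul_mem _ (constantCoeff g) ih
      ext j
      exact (hγ j).coeff_mul g (hspan ▸ hx)
  have htop : Submodule.span k (Λ '' (s : Set (MvPolynomial ι k))) = ⊤ := by
    refine eq_top_iff.2 fun w _ => ?_
    obtain ⟨f, hf, hw⟩ := hsurj w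
    exact (funext hw : Λ f = w) ▸ hsub f hf
  classical
  have hle := finrank_span_finset_le_card (R := k) (s.image Λ)
  rw [Set.finrank, Finset.coe_image, htop, finrank_top, Module.finrank_fintype_fun_eq_card] at hle
  exact hle.trans (Finset.card_image_le.trans hs.le)

/-- If all binomials of a toric ideal lie in `J`, so does the toric ideal. -/
theorem toricIdeal_le {J : Ideal (MvPolynomial ι k)}
    (hJ : ∀ α β : ι →₀ ℕ, Finsupp.linearCombination ℕ b α = Finsupp.linearCombination ℕ b β →
      monomial α (1 : k) - monomial β 1 ∈ J) : toricIdeal k b ≤ J := by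
  intro f hf
  -- A section choosing one monomial in each degree: modulo `J`, every `g` is congruent to `S (φ
  -- g)`, which is zero on the kernel.
  let s : (σ →₀ ℕ) → ι →₀ ℕ := Function.invFun (Finsupp.linearCombination ℕ b)
  let S : MvPolynomial σ k →ₗ[k] MvPolynomial ι k :=
    (basisMonomials σ k).constr k fun β => monomial (s β) (1 : k)
  have hS : ∀ β, S (monomial β 1) = monomial (s β) 1 := fun β => by
    have := (basisMonomials σ k).constr_basis k (fun β => monomial (s β) (1 : k)) β
    rwa [coe_basisMonomials] at this
  let φ := aeval (R := k) (fun i => (monomial (b i) (1 : k) : MvPolynomial σ k))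
  have key : ∀ g : MvPolynomial ι k, g - S (φ g) ∈ J := by
    intro g
    induction g using MvPolynomial.induction_on' with
    | monomial u a =>
      have hu : Finsupp.linearCombination ℕ b (s (Finsupp.linearCombination ℕ b u)) =
          Finsupp.linearCombination ℕ b u :=
        Function.invFun_eq (f := Finsupp.linearCombination ℕ b) ⟨u, rfl⟩
      have h := J.mul_mem_left (C a) (hJ u _ hu.symm)
      rw [mul_sub, ← hS, C_mul_monomial, mul_one, ← smul_eq_C_mul, ← map_smul, smul_monomial,
        smul_eq_mul, mul_one, ← aeval_monomial_exponents] at h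
      exact h
    | add p q hp hq =>
      rw [map_add, map_add, add_sub_add_comm]
      exact J.add_mem hp hq
  have hφ : φ f = 0 := hf
  simpa [hφ] using key f

/-- Setting `u = 0` and then `t = 0` after the parametrization gives two more primes in a strict
chain above the toric ideal; the dimension of the polynomial ring bounds its length. -/
theorem height_toricIdeal_add_two_le [Fintype ι] {b : ι → Fin 2 →₀ ℕ} {i j : ι} (hi : b i 1 ≠ 0)
    (hj : b j 1 = 0) (hj' : b j 0 ≠ 0) :
    (toricIdeal k b).height + 2 ≤ (Fintype.card ι : ℕ∞) := by
  let φ := aeval (R := k) (fun i => (monomial (b i) (1 : k) : MvPolynomial (Fin 2) k))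
  let χ : MvPolynomial (Fin 2) k →ₐ[k] Polynomial k := aeval ![Polynomial.X, 0]
  let ε : Polynomial k →ₐ[k] k := Polynomial.aeval 0
  have hφX : ∀ i, φ (X i) = monomial (b i) 1 := fun i => aeval_X _ _
  have hχ : ∀ β : Fin 2 →₀ ℕ, χ (monomial β 1) = Polynomial.X ^ β 0 * 0 ^ β 1 := fun β => by
    simp [χ, aeval_monomial, Finsupp.prod_fintype]
  have h0 : (toricIdeal k b).IsPrime := RingHom.ker_isPrime _
  have h1 : (RingHom.ker (χ.comp φ)).IsPrime := RingHom.ker_isPrime _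
  have h2 : (RingHom.ker (ε.comp (χ.comp φ))).IsPrime := RingHom.ker_isPrime _
  have h01 : toricIdeal k b < RingHom.ker (χ.comp φ) := by
    refine lt_of_le_of_ne (fun f hf => ?_) fun h => ?_
    · have : φ f = 0 := hf
      simp [RingHom.mem_ker, this]
    · have hX : X i ∈ RingHom.ker (χ.comp φ) := by
        simp [RingHom.mem_ker, hφX, hχ, hi]
      rw [← h] at hX
      have : φ (X i) = 0 := hX
      simp [hφX] at this
  have h12 : RingHom.ker (χ.comp φ) < RingHom.ker (ε.comp (χ.comp φ)) := by
    refine lt_of_le_of_ne (fun f hf => ?_) fun h => ?_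
    · have : χ (φ f) = 0 := hf
      simp [RingHom.mem_ker, this]
    · have hX : X j ∈ RingHom.ker (ε.comp (χ.comp φ)) := by
        simp [RingHom.mem_ker, hφX, hχ, hj, ε, hj']
      rw [← h] at hX
      simp [RingHom.mem_ker, hφX, hχ, hj] at hX
  have e1 := Ideal.height_add_one_le_of_lt_of_isPrime h01
  have e2 := Ideal.height_add_one_le_of_lt_of_isPrime h12
  have e3 := Ideal.height_le_ringKrullDim_of_isPrime (I := RingHom.ker (ε.comp (χ.comp φ)))
  rw [MvPolynomial.ringKrullDim_of_isNoetherianRing, ringKrullDim_eq_zero_of_field, zero_add,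
    Nat.card_eq_fintype_card] at e3
  have e4 : (RingHom.ker (ε.comp (χ.comp φ))).height ≤ (Fintype.card ι : ℕ∞) := by exact_mod_cast e3
  calc (toricIdeal k b).height + 2 = (toricIdeal k b).height + 1 + 1 := by
        rw [add_assoc, one_add_one_eq_two]
    _ ≤ (RingHom.ker (χ.comp φ)).height + 1 := by gcongr
    _ ≤ _ := e2.trans e4

end Toric

/-! ### Critical exponents from isolated points of a fibre. -/

section Critical

variable {ι σ : Type*} {b : ι → σ →₀ ℕ}

/-- If `w` has the degree of a proper divisor `v` of `γ = v + u`, then `w + u` lies in the fibre of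
`γ` and shares with it the support of `u`; isolation forces `w = v`. -/
theorem isCriticalExponent_of_isolated {γ : ι →₀ ℕ}
    (h : ∀ β, Finsupp.linearCombination ℕ b β = Finsupp.linearCombination ℕ b γ →
      (∃ i, γ i ≠ 0 ∧ β i ≠ 0) → β = γ) : IsCriticalExponent b γ := by
  intro v hv w hw
  obtain ⟨u, rfl⟩ := exists_add_of_le hv.le
  have hu : u ≠ 0 := by
    rintro rfl
    simp at hv
  obtain ⟨i, hi⟩ := DFunLike.ne_iff.1 hu
  have hi' : u i ≠ 0 := hi
  have := h (w + u) (by rw [map_add, map_add, hw]) ⟨i, by simp [hi'], by simp [hi']⟩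
  exact add_right_cancel this

end Critical

/-! ### Degrees and lower bounds for projective monomial curves. -/

section Projective

variable {n : ℕ} (d : Fin n → ℕ)

theorem projectiveExponents_castSucc (i : Fin n) :
    projectiveExponents d i.castSucc =
      Finsupp.equivFunOnFinite.symm ![d i, Finset.univ.sup d - d i] := by
  simp [projectiveExponents]

theorem projectiveExponents_last :
    projectiveExponents d (Fin.last n) =
      Finsupp.equivFunOnFinite.symm ![0, Finset.univ.sup d] := by
  simp [projectiveExponents]

theorem projectiveExponents_add (i : Fin (n + 1)) :
    projectiveExponents d i 0 + projectiveExponents d i 1 = Finset.univ.sup d := by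
  induction i using Fin.lastCases with
  | last => simp [projectiveExponents_last]
  | cast i =>
    have := Finset.le_sup (f := d) (Finset.mem_univ i)
    simp [projectiveExponents_castSucc, this]

theorem linearCombination_projectiveExponents_apply (α : Fin (n + 1) →₀ ℕ) (j : Fin 2) :
    Finsupp.linearCombination ℕ (projectiveExponents d) α j =
      ∑ i, α i * projectiveExponents d i j := by
  rw [Finsupp.linearCombination_apply, Finsupp.sum_fintype _ _ (by simp), Finsupp.finsetSum_apply]
  simp

theorem linearCombination_projectiveExponents_zero (α : Fin (n + 1) →₀ ℕ) :
    Finsupp.linearCombination ℕ (projectiveExponents d) α 0 = ∑ i, α i.castSucc * d i := by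
  rw [linearCombination_projectiveExponents_apply, Fin.sum_univ_castSucc]
  simp [projectiveExponents_castSucc, projectiveExponents_last]

theorem linearCombination_projectiveExponents_add (α : Fin (n + 1) →₀ ℕ) :
    Finsupp.linearCombination ℕ (projectiveExponents d) α 0 +
      Finsupp.linearCombination ℕ (projectiveExponents d) α 1 =
      (∑ i, α i) * Finset.univ.sup d := by
  simp only [linearCombination_projectiveExponents_apply, ← Finset.sum_add_distrib, ← mul_add,
    projectiveExponents_add, Finset.sum_mul]

variable {d}

theorem linearCombination_projectiveExponents_eq_iff (hD : 0 < Finset.univ.sup d)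
    {α β : Fin (n + 1) →₀ ℕ} :
    Finsupp.linearCombination ℕ (projectiveExponents d) α =
        Finsupp.linearCombination ℕ (projectiveExponents d) β ↔
      ∑ i, α i.castSucc * d i = ∑ i, β i.castSucc * d i ∧ ∑ i, α i = ∑ i, β i := by
  have hα := linearCombination_projectiveExponents_add d α
  have hβ := linearCombination_projectiveExponents_add d β
  rw [← linearCombination_projectiveExponents_zero, ← linearCombination_projectiveExponents_zero]
  constructor
  · intro h
    refine ⟨by rw [h], Nat.eq_of_mul_eq_mul_right hD ?_⟩
    rw [← hα, ← hβ, h]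
  · rintro ⟨h0, h1⟩
    ext j
    fin_cases j
    · exact h0
    · rw [h1, ← hβ, h0] at hα
      exact Nat.add_left_cancel hα

/-- The minimal pure powers of the variables `x_i`, `i ≠ m`, together with one more critical
exponent, force `n` generators. -/
theorem le_spanFinrank_projectiveToricIdeal (k : Type*) [Field k] (hpos : ∀ i, 0 < d i)
    (hinj : Function.Injective d) {m : Fin n} (hm : Finset.univ.sup d = d m)
    (hfg : (projectiveToricIdeal k d).FG) {γ γ' : Fin (n + 1) →₀ ℕ}
    (hγ : IsCriticalExponent (projectiveExponents d) γ)
    (hdeg : Finsupp.linearCombination ℕ (projectiveExponents d) γ =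
      Finsupp.linearCombination ℕ (projectiveExponents d) γ')
    (hne : γ' ≠ γ) (hpure : ∀ i c, Finsupp.single i c ≠ γ) (hpure' : ∀ i c, Finsupp.single i c ≠ γ') :
    n ≤ Submodule.spanFinrank (projectiveToricIdeal k d) := by
  have hD : 0 < Finset.univ.sup d := hm ▸ hpos m
  have hnonlone : ∀ i : {i : Fin n // i ≠ m}, ∃ c,
      ¬ IsLoneExponent (projectiveExponents d) (Finsupp.single i.1.castSucc c) := by
    rintro ⟨i, hi⟩
    -- The witness is the relation `x_i^(d_m) ~ x_m^(d_i) x_{n+1}^(d_m - d_i)`.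
    refine ⟨d m, fun h => ?_⟩
    have := h (Finsupp.single m.castSucc (d i) + Finsupp.single (Fin.last n) (d m - d i)) (by
      rw [map_add, Finsupp.linearCombination_single, Finsupp.linearCombination_single,
        Finsupp.linearCombination_single, projectiveExponents_castSucc,
        projectiveExponents_castSucc, projectiveExponents_last, hm]
      ext j
      fin_cases j
      · simp [mul_comm]
      · simp [mul_comm])
    have := DFunLike.congr_fun this m.castSucc
    simp [hi, Fin.castSucc_ne_last, (hpos i).ne'] at this
  classical
  let c : {i : Fin n // i ≠ m} → ℕ := fun i => Nat.find (hnonlone i)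
  let p : {i : Fin n // i ≠ m} → Fin (n + 1) →₀ ℕ := fun i => Finsupp.single i.1.castSucc (c i)
  have hc : ∀ i, c i ≠ 0 := by
    intro i h0
    refine Nat.find_spec (hnonlone i) fun β hβ => ?_
    change Finsupp.linearCombination ℕ _ β = Finsupp.linearCombination ℕ _ (p i) at hβ
    change β = p i
    have hp : p i = 0 := by simp [p, h0]
    rw [hp] at hβ ⊢
    have := ((linearCombination_projectiveExponents_eq_iff hD).1 hβ).2
    ext j
    simpa using (Finset.sum_eq_zero_iff.1 (this.trans (by simp))) j (Finset.mem_univ j)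
  have hq : ∀ i, ∃ q, Finsupp.linearCombination ℕ (projectiveExponents d) q =
      Finsupp.linearCombination ℕ (projectiveExponents d) (p i) ∧ q ≠ p i := by
    intro i
    have := Nat.find_spec (hnonlone i)
    rw [IsLoneExponent] at this
    push Not at this
    exact this
  choose q hqdeg hqne using hq
  have hpcrit : ∀ i, IsCriticalExponent (projectiveExponents d) (p i) := by
    intro i v hv
    have hvs : v = Finsupp.single i.1.castSucc (v i.1.castSucc) := by
      ext j
      have := hv.le j
      by_cases hj : j = i.1.castSucc
      · subst hj; simp
      · simp only [p, Finsupp.single_apply, if_neg (Ne.symm hj)] at this ⊢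
        omega
    have hlt : v i.1.castSucc < c i := by
      refine lt_of_le_of_ne (by simpa [p] using hv.le i.1.castSucc) fun h => hv.ne ?_
      rw [hvs, h]
    have := Nat.find_min (hnonlone i) hlt
    rw [not_not, ← hvs] at this
    exact this
  -- Equal degrees give equal exponents `c i = c j ≠ 0`, hence equal `d i`: the chosen powers lie in
  -- distinct degrees.
  have hpp : ∀ i j, Finsupp.linearCombination ℕ (projectiveExponents d) (p i) =
      Finsupp.linearCombination ℕ (projectiveExponents d) (p j) → i = j := by
    intro i j h
    obtain ⟨h0, h1⟩ := (linearCombination_projectiveExponents_eq_iff hD).1 h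
    have e1 : c i = c j := by
      simpa [p, Finsupp.single_apply] using h1
    have e0 : c i * d i = c j * d j := by
      simpa [p, Finsupp.single_apply] using h0
    rw [e1] at e0
    exact Subtype.ext (hinj (Nat.eq_of_mul_eq_mul_left (Nat.pos_of_ne_zero (hc j)) e0))
  let Γ : Option {i : Fin n // i ≠ m} → Fin (n + 1) →₀ ℕ := fun o => o.elim γ p
  have hcard : Fintype.card (Option {i : Fin n // i ≠ m}) = n := by
    have : 0 < n := m.pos
    simp only [Fintype.card_option, ne_eq, Fintype.card_subtype_compl, Fintype.card_fin,
      Fintype.card_subtype_eq]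
    omega
  refine hcard.symm.le.trans (card_le_spanFinrank_toricIdeal Γ ?_ hfg ?_)
  · rintro (_ | i)
    exacts [hγ, hpcrit i]
  · intro w
    let f : {i : Fin n // i ≠ m} → MvPolynomial (Fin (n + 1)) k := fun i =>
      monomial (p i) 1 - monomial (q i) 1
    let g : MvPolynomial (Fin (n + 1)) k := monomial γ 1 - monomial γ' 1
    have hf : ∀ i, f i ∈ toricIdeal k (projectiveExponents d) := fun i =>
      monomial_sub_monomial_mem_toricIdeal _ (hqdeg i).symm
    have hg : g ∈ toricIdeal k (projectiveExponents d) :=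
      monomial_sub_monomial_mem_toricIdeal _ hdeg
    have hgγ : coeff γ g = 1 := by simp [g, coeff_monomial, hne]
    have hgp : ∀ i, coeff (p i) g = 0 := fun i => by
      simp [g, coeff_monomial, p, (hpure _ _).symm, (hpure' _ _).symm]
    have hfp : ∀ i j, coeff (p i) (f j) = if j = i then 1 else 0 := fun i j => by
      by_cases h : j = i
      · subst h
        simp [f, coeff_monomial, hqne]
      · have h1 : p j ≠ p i := fun e => h (hpp _ _ (by rw [e]))
        have h2 : q j ≠ p i := fun e => h (hpp _ _ (by rw [← e, hqdeg]))
        simp [f, coeff_monomial, h, h1, h2]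
    -- The coefficient matrix is triangular: `F` fixes the pure-power coefficients, and a multiple
    -- of `g`, which has none of them, corrects the one at `γ`.
    let F := ∑ j, C (w (some j)) * f j
    have hF : F ∈ toricIdeal k (projectiveExponents d) :=
      Ideal.sum_mem _ fun j _ => Ideal.mul_mem_left _ _ (hf j)
    refine ⟨F + C (w none - coeff γ F) * g, Ideal.add_mem _ hF (Ideal.mul_mem_left _ _ hg), ?_⟩
    rintro (_ | i)
    · change coeff γ _ = _
      rw [coeff_add, coeff_C_mul, hgγ]
      ring
    · change coeff (p i) _ = _
      rw [coeff_add, coeff_C_mul, hgp, mul_zero, add_zero]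
      simp [F, coeff_sum, coeff_C_mul, hfp]

theorem le_spanFinrank_projectiveToricIdeal_of_isolated (k : Type*) [Field k] (hpos : ∀ i, 0 < d i)
    (hinj : Function.Injective d) {m : Fin n} (hm : Finset.univ.sup d = d m)
    (hfg : (projectiveToricIdeal k d).FG) (γ γ' : Fin (n + 1) → ℕ)
    (hval : ∑ i, γ i.castSucc * d i = ∑ i, γ' i.castSucc * d i) (hsum : ∑ i, γ i = ∑ i, γ' i)
    (hiso : ∀ β : Fin (n + 1) → ℕ, ∑ i, β i.castSucc * d i = ∑ i, γ i.castSucc * d i →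
      ∑ i, β i = ∑ i, γ i → (∃ i, γ i ≠ 0 ∧ β i ≠ 0) → β = γ) (hne : γ' ≠ γ)
    (hpure : ∃ i j, i ≠ j ∧ γ i ≠ 0 ∧ γ j ≠ 0) (hpure' : ∃ i j, i ≠ j ∧ γ' i ≠ 0 ∧ γ' j ≠ 0) :
    n ≤ Submodule.spanFinrank (projectiveToricIdeal k d) := by
  have hD : 0 < Finset.univ.sup d := hm ▸ hpos m
  have not_single : ∀ g : Fin (n + 1) → ℕ, (∃ i j, i ≠ j ∧ g i ≠ 0 ∧ g j ≠ 0) →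
      ∀ i c, Finsupp.single i c ≠ Finsupp.equivFunOnFinite.symm g := by
    rintro g ⟨i, j, hij, hi, hj⟩ l c h
    have h1 := DFunLike.congr_fun h i
    have h2 := DFunLike.congr_fun h j
    simp only [Finsupp.single_apply, Finsupp.equivFunOnFinite_symm_apply_apply] at h1 h2
    split_ifs at h1 h2 with e1 e2
    · exact hij (e1.symm.trans e2)
    all_goals first | exact hj h2.symm | exact hi h1.symm
  refine le_spanFinrank_projectiveToricIdeal k hpos hinj hm hfg
    (γ := Finsupp.equivFunOnFinite.symm γ) (γ' := Finsupp.equivFunOnFinite.symm γ')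
    (isCriticalExponent_of_isolated fun β hβ hsh => ?_)
    ((linearCombination_projectiveExponents_eq_iff hD).2 ⟨hval, hsum⟩)
    (Finsupp.equivFunOnFinite.symm.injective.ne hne) (not_single γ hpure) (not_single γ' hpure')
  obtain ⟨h0, h1⟩ := (linearCombination_projectiveExponents_eq_iff hD).1 hβ
  exact DFunLike.coe_injective (hiso β h0 h1 hsh)

/-- A pair of disjoint products of two distinct variables of the same degree forces `n`
generators. -/
theorem le_spanFinrank_projectiveToricIdeal_of_quadric (k : Type*) [Field k] (hpos : ∀ i, 0 < d i)
    (hinj : Function.Injective d) {m : Fin n} (hm : Finset.univ.sup d = d m)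
    (hfg : (projectiveToricIdeal k d).FG) {p q r s : Fin n} (hpq : p ≠ q) (hrs : r ≠ s)
    (hpr : p ≠ r) (hps : p ≠ s) (hval : d p + d q = d r + d s) :
    n ≤ Submodule.spanFinrank (projectiveToricIdeal k d) := by
  -- Weight 0 for the last variable keeps the weights distinct, so a quadratic monomial is
  -- determined by one factor and its total weight.
  let e : Fin (n + 1) → ℕ := Fin.snoc (α := fun _ => ℕ) d 0
  have he : Function.Injective e := by
    refine Fin.snoc_injective_iff.2 ⟨hinj, ?_⟩
    rintro ⟨i, hi⟩
    exact (hpos i).ne' hi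
  have hev : ∀ β : Fin (n + 1) → ℕ, ∑ i, β i.castSucc * d i = ∑ i, β i * e i := fun β => by
    simp [Fin.sum_univ_castSucc, e]
  have hsplit : ∀ (β : Fin (n + 1) → ℕ) i, β i ≠ 0 → ∃ w : Fin (n + 1) → ℕ, β = Pi.single i 1 + w := by
    intro β i hi
    refine ⟨β - Pi.single i 1, (add_tsub_cancel_of_le fun j => ?_).symm⟩
    by_cases hj : j = i
    · subst hj; simpa using Nat.one_le_iff_ne_zero.2 hi
    · simp [hj]
  have hvs : ∀ (i : Fin (n + 1)) (w : Fin (n + 1) → ℕ),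
      ∑ j, (Pi.single i 1 + w : Fin (n + 1) → ℕ) j * e j = e i + ∑ j, w j * e j := fun i w => by
    simp [add_mul, Finset.sum_add_distrib, Pi.single_apply]
  have hss : ∀ (i : Fin (n + 1)) (w : Fin (n + 1) → ℕ),
      ∑ j, (Pi.single i 1 + w : Fin (n + 1) → ℕ) j = 1 + ∑ j, w j := fun i w => by
    simp [Finset.sum_add_distrib]
  have key : ∀ (x y : Fin (n + 1)) (β : Fin (n + 1) → ℕ), β x ≠ 0 →
      ∑ j, β j * e j = e x + e y → ∑ j, β j = 2 → β = Pi.single x 1 + Pi.single y 1 := by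
    intro x y β hx h1 h2
    obtain ⟨w, rfl⟩ := hsplit β x hx
    rw [hvs] at h1
    rw [hss] at h2
    obtain ⟨z, -, hz⟩ := Finset.exists_ne_zero_of_sum_ne_zero
      (s := Finset.univ) (f := w) (by omega)
    obtain ⟨v, rfl⟩ := hsplit w z hz
    rw [hss] at h2
    have hv : v = 0 := by
      ext j
      exact Finset.sum_eq_zero_iff.1 (show ∑ j, v j = 0 by omega) j (Finset.mem_univ j)
    subst hv
    rw [hvs] at h1
    have : e z = e y := by simpa using h1
    rw [he this, add_zero]
  have hsv : ∀ x y : Fin n, ∑ j, (Pi.single x.castSucc 1 + Pi.single y.castSucc 1 : Fin (n + 1) → ℕ) j * e j =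
      d x + d y := fun x y => by
    rw [← add_zero (Pi.single y.castSucc 1), hvs, hvs]
    simp [e]
  have hs2 : ∀ x y : Fin n,
      ∑ j, (Pi.single x.castSucc 1 + Pi.single y.castSucc 1 : Fin (n + 1) → ℕ) j = 2 := fun x y => by
    rw [hss]; simp
  have hnz : ∀ x y : Fin n, x ≠ y → ∃ i j : Fin (n + 1), i ≠ j ∧
      (Pi.single x.castSucc 1 + Pi.single y.castSucc 1 : Fin (n + 1) → ℕ) i ≠ 0 ∧
      (Pi.single x.castSucc 1 + Pi.single y.castSucc 1 : Fin (n + 1) → ℕ) j ≠ 0 := fun x y hxy =>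
    ⟨x.castSucc, y.castSucc, by simpa using hxy, by simp, by simp⟩
  refine le_spanFinrank_projectiveToricIdeal_of_isolated k hpos hinj hm hfg
    (Pi.single p.castSucc 1 + Pi.single q.castSucc 1)
    (Pi.single r.castSucc 1 + Pi.single s.castSucc 1) ?_ ?_ ?_ ?_ (hnz _ _ hpq) (hnz _ _ hrs)
  · rw [hev, hev, hsv, hsv, hval]
  · rw [hs2, hs2]
  · rintro β h1 h2 ⟨i, hi, hβ⟩
    rw [hev, hev, hsv] at h1
    rw [hs2] at h2
    by_cases hip : i = p.castSucc
    · subst hip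
      exact key _ _ β hβ (by simpa [e] using h1) h2
    · have hiq : i = q.castSucc := by
        by_contra hiq
        simp [hip, hiq] at hi
      subst hiq
      refine Eq.trans ?_ (add_comm (Pi.single q.castSucc 1) (Pi.single p.castSucc 1))
      exact key _ _ β hβ (by simpa [e, add_comm] using h1) h2
  · intro h
    have := congrFun h p.castSucc
    simp [Pi.single_apply, hpr, hps] at this
    omega

end Projective

/-! ### Isolation of the extra monomials in their fibres. -/

section Fibres

/-- The fibre of `x_1 ^ h * x_3` for the exponents `a, h * a + δ, h * a + 2 * δ`. -/
theorem isolated_of_three {h a δ i j l r : ℕ} (hh : 0 < h) (ha : 0 < a) (hδ : 0 < δ)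
    (hval : i * a + j * (h * a + δ) + l * (h * a + 2 * δ) = h * a + (h * a + 2 * δ))
    (hsum : i + j + l + r = h + 1) (hil : i ≠ 0 ∨ l ≠ 0) : i = h ∧ j = 0 ∧ l = 1 ∧ r = 0 := by
  have hA : 0 < h * a := Nat.mul_pos hh ha
  have haA : a ≤ h * a := Nat.le_mul_of_pos_left a hh
  have hi0 : i ≠ 0 → 0 < i * a := fun hi => Nat.mul_pos (Nat.pos_of_ne_zero hi) ha
  have hih : i ≤ h → i * a ≤ h * a := fun hi => Nat.mul_le_mul_right a hi
  have hih' : i ≤ h + 1 → i * a ≤ h * a + a := fun hi => by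
    rw [← Nat.succ_mul]; exact Nat.mul_le_mul_right a hi
  have hinj : i * a = h * a → i = h := fun h => Nat.eq_of_mul_eq_mul_right ha h
  generalize h * a = A at *
  have hjl : j + l ≤ 2 := by
    by_contra hc
    have : 3 * (A + δ) ≤ (j + l) * (A + δ) := Nat.mul_le_mul_right _ (by omega)
    nlinarith
  have hj : j ≤ 2 := by omega
  have hl : l ≤ 2 := by omega
  interval_cases j <;> interval_cases l <;> omega

/-- The fibre of `x_1 ^ h * x_4` for the exponents `a, h * a + δ, h * a + 2 * δ, h * a + 3 * δ`. -/
theorem isolated_of_four {h a δ i j l m r : ℕ} (hh : 0 < h) (ha : 1 < a) (hδ : 0 < δ)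
    (hcop : Nat.Coprime a δ)
    (hval : i * a + j * (h * a + δ) + l * (h * a + 2 * δ) + m * (h * a + 3 * δ) =
      h * a + (h * a + 3 * δ))
    (hsum : i + j + l + m + r = h + 1) (him : i ≠ 0 ∨ m ≠ 0) :
    i = h ∧ j = 0 ∧ l = 0 ∧ m = 1 ∧ r = 0 := by
  have hA : 0 < h * a := Nat.mul_pos hh (by omega)
  have haA : a ≤ h * a := Nat.le_mul_of_pos_left a hh
  have hi0 : i ≠ 0 → 0 < i * a := fun hi => Nat.mul_pos (Nat.pos_of_ne_zero hi) (by omega)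
  have hih : i ≤ h → i * a ≤ h * a := fun hi => Nat.mul_le_mul_right a hi
  have hih' : i ≤ h + 1 → i * a ≤ h * a + a := fun hi => by
    rw [← Nat.succ_mul]; exact Nat.mul_le_mul_right a hi
  have hinj : i * a = h * a → i = h := fun h => Nat.eq_of_mul_eq_mul_right (by omega) h
  -- This excludes `x_1^i x_2^2`, which has the right weight exactly when `i a = δ`; here `a > 1` is
  -- essential.
  have hdvd : i * a ≠ δ := fun h => by
    have : a ∣ δ := ⟨i, by rw [← h, mul_comm]⟩
    have := Nat.Coprime.eq_one_of_dvd hcop this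
    omega
  generalize h * a = A at *
  have hjl : j + l + m ≤ 2 := by
    by_contra hc
    have : 3 * (A + δ) ≤ (j + l + m) * (A + δ) := Nat.mul_le_mul_right _ (by omega)
    nlinarith
  have hj : j ≤ 2 := by omega
  have hl : l ≤ 2 := by omega
  have hm : m ≤ 2 := by omega
  interval_cases j <;> interval_cases l <;> interval_cases m <;> omega

/-- The fibre of `x_1 ^ δ * x_2` for the exponents `1, h + δ, h + 2 * δ, h + 3 * δ`. -/
theorem isolated_of_four_of_one {h δ i j l m r : ℕ} (hh : 0 < h) (hδ : 0 < δ)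
    (hval : i + j * (h + δ) + l * (h + 2 * δ) + m * (h + 3 * δ) = δ + (h + δ))
    (hsum : i + j + l + m + r = δ + 1) (him : i ≠ 0 ∨ j ≠ 0) :
    i = δ ∧ j = 1 ∧ l = 0 ∧ m = 0 ∧ r = 0 := by
  have hjl : j + l + m ≤ 1 := by
    by_contra hc
    have : 2 * (h + δ) ≤ (j + l + m) * (h + δ) := Nat.mul_le_mul_right _ (by omega)
    nlinarith
  have hj : j ≤ 1 := by omega
  have hl : l ≤ 1 := by omega
  have hm : m ≤ 1 := by omega
  interval_cases j <;> interval_cases l <;> interval_cases m <;> omega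

/-- The fibre of `x_1 ^ (m + δ) * x_2` for the exponents `a, a + δ, a + 2 * δ`, `a = 2 * m + 1`. -/
theorem isolated_of_three_of_odd {m δ i j l r : ℕ} (hδ : 0 < δ)
    (hcop : Nat.Coprime (2 * m + 1) δ)
    (hval : i * (2 * m + 1) + j * (2 * m + 1 + δ) + l * (2 * m + 1 + 2 * δ) =
      (m + δ) * (2 * m + 1) + (2 * m + 1 + δ))
    (hsum : i + j + l + r = m + δ + 1) (hij : i ≠ 0 ∨ j ≠ 0) :
    i = m + δ ∧ j = 1 ∧ l = 0 ∧ r = 0 := by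
  zify at hval hsum
  have hc : IsCoprime ((2 * m + 1 : ℕ) : ℤ) (δ : ℤ) := Nat.isCoprime_iff_coprime.2 hcop
  -- Reduce the weights modulo `a = 2m + 1` and cancel `δ`. For the quotient `t`, the case `t > 0`
  -- has too many factors, `t = 0` is the monomial itself, and `t < 0` forces `i = j = 0`.
  have hdvd : ((2 * m + 1 : ℕ) : ℤ) ∣ 1 - j - 2 * l := by
    refine hc.dvd_of_dvd_mul_left ⟨i + j + l - m - 1 - δ, ?_⟩
    push_cast
    linear_combination -hval
  obtain ⟨t, ht⟩ := hdvd
  push_cast at ht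
  have hijl : (i + j + l : ℤ) = m + 1 + δ + δ * t := by
    have h0 : ((2 * m + 1 : ℕ) : ℤ) ≠ 0 := by positivity
    apply mul_left_cancel₀ h0
    push_cast
    linear_combination hval + δ * ht
  have ht1 : t ≤ 0 := by
    by_contra hc
    nlinarith
  rcases eq_or_lt_of_le ht1 with rfl | ht0
  · simp only [mul_zero] at ht hijl
    omega
  · have : (δ : ℤ) * t ≤ -δ := by nlinarith
    have : (2 * m + 1 : ℤ) * t ≤ -(2 * m + 1) := by nlinarith
    omega

end Fibres

theorem le_spanFinrank_of_arithmetic (k : Type*) [Field k] {n : ℕ} (hn : 3 ≤ n) {d : Fin n → ℕ}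
    {h a δ : ℕ} (hh : 0 < h) (ha : 0 < a) (hδ : 0 < δ) (hcop : Nat.Coprime a δ)
    (hd0 : d ⟨0, by omega⟩ = a) (hd : ∀ i : Fin n, (i : ℕ) ≠ 0 → d i = h * a + i * δ)
    (hinj : Function.Injective d) {M : Fin n} (hm : Finset.univ.sup d = d M)
    (hfg : (projectiveToricIdeal k d).FG) (hnot : ¬ (n = 3 ∧ h = 1 ∧ Even a)) :
    n ≤ Submodule.spanFinrank (projectiveToricIdeal k d) := by
  have hpos : ∀ i, 0 < d i := by
    intro i
    by_cases hi : (i : ℕ) = 0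
    · have : i = ⟨0, by omega⟩ := Fin.ext hi
      rw [this, hd0]; exact ha
    · rw [hd i hi]; positivity
  rcases (by omega : n = 3 ∨ n = 4 ∨ 5 ≤ n) with rfl | rfl | hn5
  · have e0 : d 0 = a := hd0
    have e1 : d 1 = h * a + δ := by simpa using hd 1 (by simp)
    have e2 : d 2 = h * a + 2 * δ := by simpa using hd 2 (by simp)
    by_cases h1 : h = 1
    · subst h1
      have hodd : Odd a := Nat.not_even_iff_odd.1 fun he => hnot ⟨rfl, rfl, he⟩
      obtain ⟨m, rfl⟩ := hodd
      rw [one_mul] at e1 e2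
      refine le_spanFinrank_projectiveToricIdeal_of_isolated k hpos hinj hm hfg
        ![m + δ, 1, 0, 0] ![0, 0, m + 1, δ] ?_ ?_ ?_ ?_ ⟨0, 1, by simp; omega⟩
          ⟨2, 3, by simp; omega⟩
      · simp [Fin.sum_univ_three, e0, e1, e2]; ring
      · simp [Fin.sum_univ_four]; ring
      · intro β h0 h1 hsh
        simp [Fin.sum_univ_three, Fin.sum_univ_four, e0, e1, e2, Fin.exists_fin_succ] at h0 h1 hsh
        have := isolated_of_three_of_odd hδ hcop h0 h1 (by tauto)
        ext i
        fin_cases i <;> simp [this]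
      · intro h; simpa using congrFun h 1
    · refine le_spanFinrank_projectiveToricIdeal_of_isolated k hpos hinj hm hfg
        ![h, 0, 1, 0] ![0, 2, 0, h - 1] ?_ ?_ ?_ ?_ ⟨0, 2, by simp; omega⟩ ⟨1, 3, by simp; omega⟩
      · simp [Fin.sum_univ_three, e0, e1, e2]; ring
      · simp [Fin.sum_univ_four]; omega
      · intro β h0 h1 hsh
        simp [Fin.sum_univ_three, Fin.sum_univ_four, e0, e1, e2, Fin.exists_fin_succ] at h0 h1 hsh
        have := isolated_of_three hh ha hδ h0 h1 (by tauto)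
        ext i
        fin_cases i <;> simp [this]
      · intro h; simpa using congrFun h 1
  · have e0 : d 0 = a := hd0
    have e1 : d 1 = h * a + δ := by simpa using hd 1 (by simp)
    have e2 : d 2 = h * a + 2 * δ := by simpa using hd 2 (by simp)
    have e3 : d 3 = h * a + 3 * δ := by simpa using hd 3 (by simp)
    by_cases ha1 : a = 1
    · subst ha1
      rw [mul_one] at e1 e2 e3
      refine le_spanFinrank_projectiveToricIdeal_of_isolated k hpos hinj hm hfg
        ![δ, 1, 0, 0, 0] ![0, 0, 1, 0, δ] ?_ ?_ ?_ ?_ ⟨0, 1, by simp; omega⟩ ⟨2, 4, by simp; omega⟩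
      · simp [Fin.sum_univ_four, e0, e1, e2, e3]; ring
      · simp [Fin.sum_univ_five]; ring
      · intro β h0 h1 hsh
        simp [Fin.sum_univ_four, Fin.sum_univ_five, e0, e1, e2, e3, Fin.exists_fin_succ]
          at h0 h1 hsh
        have := isolated_of_four_of_one hh hδ h0 h1 (by tauto)
        ext i
        fin_cases i <;> simp [this]
      · intro h; simpa using congrFun h 1
    · refine le_spanFinrank_projectiveToricIdeal_of_isolated k hpos hinj hm hfg
        ![h, 0, 0, 1, 0] ![0, 1, 1, 0, h - 1] ?_ ?_ ?_ ?_ ⟨0, 3, by simp; omega⟩ ⟨1, 2, by simp⟩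
      · simp [Fin.sum_univ_four, e0, e1, e2, e3]; ring
      · simp [Fin.sum_univ_five]; omega
      · intro β h0 h1 hsh
        simp [Fin.sum_univ_four, Fin.sum_univ_five, e0, e1, e2, e3, Fin.exists_fin_succ]
          at h0 h1 hsh
        have := isolated_of_four hh (by omega) hδ hcop h0 h1 (by tauto)
        ext i
        fin_cases i <;> simp [this]
      · intro h; simpa using congrFun h 1
  · refine le_spanFinrank_projectiveToricIdeal_of_quadric k hpos hinj hm hfg
      (p := ⟨1, by omega⟩) (q := ⟨4, by omega⟩) (r := ⟨2, by omega⟩) (s := ⟨3, by omega⟩)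
      (by simp) (by simp) (by simp) (by simp) ?_
    rw [hd _ (by simp), hd _ (by simp), hd _ (by simp), hd _ (by simp)]
    ring

/-! ### The complete intersection case. -/

section CompleteIntersection

theorem pow_mul_pow_eq_normalForm {A : Type*} [CommRing A] {x y z w : A} {m P δ : ℕ}
    (h1 : y ^ 2 = x * z) (h2 : x ^ P = z ^ m * w ^ δ) (i j l r : ℕ) :
    x ^ i * y ^ j * z ^ l * w ^ r =
      x ^ ((i + j / 2) % P) * y ^ (j % 2) * z ^ (l + j / 2 + m * ((i + j / 2) / P)) *
        w ^ (r + δ * ((i + j / 2) / P)) := by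
  have hy : y ^ j = (x * z) ^ (j / 2) * y ^ (j % 2) := by
    conv_lhs => rw [← Nat.div_add_mod j 2, pow_add, pow_mul, h1]
  have hx : x ^ (i + j / 2) =
      (z ^ m * w ^ δ) ^ ((i + j / 2) / P) * x ^ ((i + j / 2) % P) := by
    conv_lhs => rw [← Nat.div_add_mod (i + j / 2) P, pow_add, pow_mul, h2]
  calc x ^ i * y ^ j * z ^ l * w ^ r
      = x ^ (i + j / 2) * y ^ (j % 2) * z ^ (l + j / 2) * w ^ r := by rw [hy]; ring
    _ = _ := by rw [hx]; ring

/-- As `δ` is odd, the parity of the weight determines `j`. After halving, reduction modulo `m + δ`,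
which is coprime to `m`, determines `i`. -/
theorem normalForm_unique {m δ i j l r i' j' l' r' : ℕ} (hδ : 0 < δ)
    (hcop : Nat.Coprime (2 * m) δ) (hi : i < m + δ) (hi' : i' < m + δ) (hj : j < 2) (hj' : j' < 2)
    (hval : i * (2 * m) + j * (2 * m + δ) + l * (2 * m + 2 * δ) =
      i' * (2 * m) + j' * (2 * m + δ) + l' * (2 * m + 2 * δ))
    (hsum : i + j + l + r = i' + j' + l' + r') : i = i' ∧ j = j' ∧ l = l' ∧ r = r' := by
  have hodd : Odd δ := Nat.Coprime.odd_of_left (Nat.Coprime.coprime_mul_right hcop)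
  obtain ⟨s, rfl⟩ := hodd
  have hjj : j = j' := by
    have := congrArg (· % 2) hval
    ring_nf at this
    interval_cases j <;> interval_cases j' <;> first | rfl | (ring_nf at this; omega)
  subst hjj
  have hv : m * i + (m + (2 * s + 1)) * l = m * i' + (m + (2 * s + 1)) * l' := by nlinarith
  have hii : i = i' := by
    have hc : Nat.Coprime (m + (2 * s + 1)) m := by
      rw [Nat.coprime_self_add_left]
      exact (Nat.Coprime.coprime_mul_left hcop).symm
    refine Nat.ModEq.eq_of_lt_of_lt (m := m + (2 * s + 1)) ?_ hi hi'
    refine Nat.ModEq.cancel_left_of_coprime hc (c := m) ?_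
    have := congrArg (· % (m + (2 * s + 1))) hv
    simpa [Nat.ModEq] using this
  subst hii
  have : l = l' := Nat.eq_of_mul_eq_mul_left (show 0 < m + (2 * s + 1) by omega) (by omega)
  omega

theorem isCompleteIntersectionIdeal_of_even (k : Type*) [Field k] {d : Fin 3 → ℕ} {m δ : ℕ}
    (hδ : 0 < δ) (hcop : Nat.Coprime (2 * m) δ) (e0 : d 0 = 2 * m) (e1 : d 1 = 2 * m + δ)
    (e2 : d 2 = 2 * m + 2 * δ) (hD : 0 < Finset.univ.sup d) :
    IsCompleteIntersectionIdeal (projectiveToricIdeal k d) := by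
  set b := projectiveExponents d with hb
  let φ := aeval (R := k) (fun i => (monomial (b i) (1 : k) : MvPolynomial (Fin 2) k))
  have hφX : ∀ i, φ (X i) = monomial (b i) 1 := fun i => aeval_X _ _
  set f : MvPolynomial (Fin 4) k := X 1 ^ 2 - X 0 * X 2 with hf
  set g : MvPolynomial (Fin 4) k := X 0 ^ (m + δ) - X 2 ^ m * X 3 ^ δ with hg
  have hmon : ∀ α : Fin 4 →₀ ℕ, (monomial α (1 : k)) =
      X 0 ^ α 0 * X 1 ^ α 1 * X 2 ^ α 2 * X 3 ^ α 3 := fun α => by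
    rw [monomial_eq, Finsupp.prod_fintype _ _ (by simp), Fin.prod_univ_four]
    simp
  have hdeg : ∀ α β : Fin 4 →₀ ℕ,
      Finsupp.linearCombination ℕ b α = Finsupp.linearCombination ℕ b β ↔
      α 0 * (2 * m) + α 1 * (2 * m + δ) + α 2 * (2 * m + 2 * δ) =
        β 0 * (2 * m) + β 1 * (2 * m + δ) + β 2 * (2 * m + 2 * δ) ∧
      α 0 + α 1 + α 2 + α 3 = β 0 + β 1 + β 2 + β 3 := fun α β => by
    rw [hb, linearCombination_projectiveExponents_eq_iff hD]
    simp [Fin.sum_univ_three, Fin.sum_univ_four, e0, e1, e2]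
  have hfI : f ∈ projectiveToricIdeal k d := by
    have := monomial_sub_monomial_mem_toricIdeal (k := k) b
      (α := Finsupp.equivFunOnFinite.symm ![0, 2, 0, 0])
      (β := Finsupp.equivFunOnFinite.symm ![1, 0, 1, 0])
      ((hdeg _ _).2 ⟨by simp; ring, by simp⟩)
    rw [hmon, hmon] at this
    change _ ∈ toricIdeal k b
    simpa [hf] using this
  have hgI : g ∈ projectiveToricIdeal k d := by
    have := monomial_sub_monomial_mem_toricIdeal (k := k) b
      (α := Finsupp.equivFunOnFinite.symm ![m + δ, 0, 0, 0])
      (β := Finsupp.equivFunOnFinite.symm ![0, 0, m, δ])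
      ((hdeg _ _).2 ⟨by simp; ring, by simp⟩)
    rw [hmon, hmon] at this
    change _ ∈ toricIdeal k b
    simpa [hg] using this
  have hle : projectiveToricIdeal k d ≤ Ideal.span {f, g} := by
    refine toricIdeal_le fun α β hαβ => ?_
    rw [← Ideal.Quotient.mk_eq_mk_iff_sub_mem, hmon, hmon]
    simp only [map_mul, map_pow]
    have hq1 : Ideal.Quotient.mk (Ideal.span {f, g}) (X 1) ^ 2 =
        Ideal.Quotient.mk (Ideal.span {f, g}) (X 0) *
          Ideal.Quotient.mk (Ideal.span {f, g}) (X 2) := by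
      rw [← map_pow, ← map_mul, Ideal.Quotient.mk_eq_mk_iff_sub_mem]
      exact Ideal.subset_span (by simp [hf])
    have hq2 : Ideal.Quotient.mk (Ideal.span {f, g}) (X 0) ^ (m + δ) =
        Ideal.Quotient.mk (Ideal.span {f, g}) (X 2) ^ m *
          Ideal.Quotient.mk (Ideal.span {f, g}) (X 3) ^ δ := by
      rw [← map_pow, ← map_pow, ← map_pow, ← map_mul, Ideal.Quotient.mk_eq_mk_iff_sub_mem]
      exact Ideal.subset_span (by simp [hg])
    obtain ⟨hv, hs⟩ := (hdeg α β).1 hαβ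
    have hP : 0 < m + δ := by omega
    obtain ⟨n0, n1, n2, n3⟩ := normalForm_unique
      (l := α 2 + α 1 / 2 + m * ((α 0 + α 1 / 2) / (m + δ)))
      (r := α 3 + δ * ((α 0 + α 1 / 2) / (m + δ)))
      (l' := β 2 + β 1 / 2 + m * ((β 0 + β 1 / 2) / (m + δ)))
      (r' := β 3 + δ * ((β 0 + β 1 / 2) / (m + δ))) hδ hcop
      (Nat.mod_lt (α 0 + α 1 / 2) hP) (Nat.mod_lt (β 0 + β 1 / 2) hP)
      (Nat.mod_lt (α 1) two_pos) (Nat.mod_lt (β 1) two_pos) (by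
        have a1 := Nat.div_add_mod (α 1) 2
        have a2 := Nat.div_add_mod (α 0 + α 1 / 2) (m + δ)
        have b1 := Nat.div_add_mod (β 1) 2
        have b2 := Nat.div_add_mod (β 0 + β 1 / 2) (m + δ)
        zify at a1 a2 b1 b2 hv ⊢
        linear_combination hv + (2 * m + δ) * (a1 - b1) + 2 * m * (a2 - b2)) (by
        have a1 := Nat.div_add_mod (α 1) 2
        have a2 := Nat.div_add_mod (α 0 + α 1 / 2) (m + δ)
        have b1 := Nat.div_add_mod (β 1) 2
        have b2 := Nat.div_add_mod (β 0 + β 1 / 2) (m + δ)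
        zify at a1 a2 b1 b2 hs ⊢
        linear_combination hs + (a1 - b1) + (a2 - b2))
    rw [pow_mul_pow_eq_normalForm hq1 hq2, pow_mul_pow_eq_normalForm hq1 hq2 (β 0),
      n0, n1, n2, n3]
  have hspan : projectiveToricIdeal k d = Ideal.span {f, g} := by
    refine le_antisymm hle (Ideal.span_le.2 ?_)
    rintro x (rfl | rfl)
    exacts [hfI, hgI]
  have hprime : (projectiveToricIdeal k d).IsPrime := RingHom.ker_isPrime _
  have hrank : Submodule.spanFinrank (projectiveToricIdeal k d) ≤ 2 := by
    rw [hspan]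
    exact (Submodule.spanFinrank_span_le_ncard_of_finite (Set.toFinite _)).trans
      ((Set.ncard_insert_le _ _).trans (by rw [Set.ncard_singleton]))
  have hheight : (2 : ℕ∞) ≤ (projectiveToricIdeal k d).height := by
    -- Multiplying the image of `x_4` by a new variable frees it from the other three. The kernel is
    -- a prime strictly between `⊥` and the toric ideal: it contains `f`, which omits `x_4`, but not
    -- `g`.
    let ψ : MvPolynomial (Fin 4) k →ₐ[k] Polynomial (MvPolynomial (Fin 2) k) :=
      aeval fun i => Polynomial.C (monomial (b i) (1 : k)) * if i = 3 then Polynomial.X else 1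
    have hψX : ∀ i, ψ (X i) =
        Polynomial.C (monomial (b i) (1 : k)) * if i = 3 then Polynomial.X else 1 :=
      fun i => aeval_X _ _
    let ev : Polynomial (MvPolynomial (Fin 2) k) →ₐ[k] MvPolynomial (Fin 2) k :=
      (Polynomial.aeval (1 : MvPolynomial (Fin 2) k)).restrictScalars k
    have hev : ev.comp ψ = φ := by
      refine MvPolynomial.algHom_ext fun i => ?_
      rw [AlgHom.comp_apply, hψX, hφX]
      split_ifs <;> simp [ev]
    have hQ : (RingHom.ker ψ).IsPrime := RingHom.ker_isPrime _
    have hbot : (⊥ : Ideal (MvPolynomial (Fin 4) k)).IsPrime := Ideal.isPrime_bot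
    have hfQ : f ∈ RingHom.ker ψ := by
      have h : φ f = 0 := hfI
      rw [hf, map_sub, map_pow, map_mul, hφX, hφX, hφX] at h
      rw [RingHom.mem_ker, hf, map_sub, map_pow, map_mul, hψX, hψX, hψX]
      simp only [Fin.reduceEq, if_false, mul_one]
      rw [← Polynomial.C_pow, ← Polynomial.C_mul, ← Polynomial.C_sub, h, Polynomial.C_0]
    have hf0 : f ≠ 0 := fun h => by
      have := congrArg (aeval (R := k) ![(0 : k), 1, 0, 0]) h
      simp [hf] at this
    have hgQ : g ∉ RingHom.ker ψ := fun h => by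
      rw [RingHom.mem_ker] at h
      have := congrArg (Polynomial.eval 0) h
      simp [hg, hψX, hδ.ne', monomial_pow] at this
    have h1 : ⊥ < RingHom.ker ψ :=
      bot_lt_iff_ne_bot.2 fun h => hf0 (by rw [h] at hfQ; exact hfQ)
    have h2 : RingHom.ker ψ < projectiveToricIdeal k d := by
      refine lt_of_le_of_ne (fun x hx => ?_) fun h => hgQ (h ▸ hgI)
      change φ x = 0
      rw [← hev, AlgHom.comp_apply, (RingHom.mem_ker).1 hx, map_zero]
    have t1 := Ideal.height_add_one_le_of_lt_of_isPrime h1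
    have t2 := Ideal.height_add_one_le_of_lt_of_isPrime h2
    rw [Ideal.height_bot, zero_add] at t1
    calc (2 : ℕ∞) = 1 + 1 := by norm_num
      _ ≤ (RingHom.ker ψ).height + 1 := by gcongr
      _ ≤ _ := t2
  refine ⟨IsNoetherian.noetherian _, le_antisymm ?_ (Ideal.height_le_spanFinrank _ hprime.ne_top)⟩
  exact le_trans (by exact_mod_cast hrank) hheight

end CompleteIntersection

theorem mainTheorem5 (k : Type*) [Field k] (n : ℕ) (hn : 3 ≤ n) (d : Fin n → ℕ)
    (hpos : ∀ i, 0 < d i) (hgcd : Finset.univ.gcd d = 1)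
    (hd : IsGeneralizedArithmeticSequence d) :
    IsCompleteIntersectionIdeal (projectiveToricIdeal k d) ↔
      n = 3 ∧ IsArithmeticSequence d ∧ Even (d ⟨0, by omega⟩) := by
  obtain ⟨h, hh, A, δ, hδ, hA⟩ := hd
  obtain ⟨a, ha⟩ : ∃ a, d ⟨0, by omega⟩ = a := ⟨_, rfl⟩
  have ha0 : 0 < a := ha ▸ hpos _
  have hAa : A = h * a := by simpa [ha] using (hA ⟨0, by omega⟩).symm
  subst hAa
  have hdi : ∀ i : Fin n, (i : ℕ) ≠ 0 → d i = h * a + i * δ := fun i hi => by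
    simpa [hi] using hA i
  have hcop : Nat.Coprime a δ := by
    refine Nat.dvd_one.1 (hgcd ▸ Finset.dvd_gcd fun i _ => ?_)
    by_cases hi : (i : ℕ) = 0
    · rw [show i = ⟨0, by omega⟩ from Fin.ext hi, ha]
      exact Nat.gcd_dvd_left _ _
    · rw [hdi i hi]
      exact dvd_add ((Nat.gcd_dvd_left _ _).mul_left _) ((Nat.gcd_dvd_right _ _).mul_left _)
  have hmono : StrictMono d := by
    intro i j hij
    have hij' : (i : ℕ) < j := hij
    rw [hdi j (by omega)]
    by_cases hi : (i : ℕ) = 0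
    · rw [show i = ⟨0, by omega⟩ from Fin.ext hi, ha]
      have : 0 < j * δ := Nat.mul_pos (by omega) hδ
      have : a ≤ h * a := Nat.le_mul_of_pos_left a hh
      omega
    · rw [hdi i hi]
      gcongr
  let M : Fin n := ⟨n - 1, by omega⟩
  have hM : Finset.univ.sup d = d M := by
    refine le_antisymm (Finset.sup_le fun i _ => hmono.monotone ?_) (Finset.le_sup (Finset.mem_univ M))
    exact Fin.le_def.2 (by simp only [M]; omega)
  constructor
  · rintro ⟨hfg, hci⟩
    have hht : (projectiveToricIdeal k d).height + 2 ≤ (Fintype.card (Fin (n + 1)) : ℕ∞) :=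
      height_toricIdeal_add_two_le (i := Fin.last n) (j := M.castSucc)
        (by rw [projectiveExponents_last]; simpa [hM] using (hpos M).ne')
        (by rw [projectiveExponents_castSucc]; simp [hM])
        (by rw [projectiveExponents_castSucc]; simpa using (hpos M).ne')
    rw [← hci, Fintype.card_fin] at hht
    have hlt : Submodule.spanFinrank (projectiveToricIdeal k d) + 2 ≤ n + 1 := by
      exact_mod_cast hht
    by_contra hcon
    have := le_spanFinrank_of_arithmetic k hn hh ha0 hδ hcop ha hdi hmono.injective hM hfg (by
      rintro ⟨h3, rfl, he⟩
      refine hcon ⟨h3, ⟨a, δ, hδ, fun i => ?_⟩, ha ▸ he⟩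
      simpa using hA i)
    omega
  · rintro ⟨rfl, ⟨a', δ', hδ', hd'⟩, he⟩
    have ea : a' = a := by
      have := hd' ⟨0, by omega⟩
      rw [ha] at this
      simpa using this.symm
    -- The difference `d_3 - d_2` equals both `δ'` and `δ`, so the two progressions coincide.
    have e1 := hd' 1
    have e2 := hd' 2
    have f1 := hdi 1 (by simp)
    have f2 := hdi 2 (by simp)
    simp at e1 e2 f1 f2
    have hδδ : δ' = δ := by omega
    subst hδδ ea
    rw [ha] at he
    obtain ⟨m, rfl⟩ := he.two_dvd
    exact isCompleteIntersectionIdeal_of_even k hδ hcop ha e1 e2 (hM ▸ hpos M)
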